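/- **Theorem B.** Let $(G,H;\Gamma)$ be an abelian cut-and-project scheme: $G$ and $H$ are locally compact second countable (Hausdorff) abelian groups, written additively, with fixed Haar measures $m_G,m_H$, and $\Gamma<G\times H$ is a lattice (a discrete subgroup of finite covolume with respect to $m_G\otimes m_H$) such that $\mathrm{proj}_G|_\Gamma$ is injective and $\mathrm{proj}_H(\Gamma)$ is dense in $H$. Let $\Xi=\Gamma\backslash(G\times H)$ with its Haar probability measure $\xi$ and the $G$-action $g_0.\Gamma(g,h)=\Gamma(g-g_0,h)$. Let $W\subset H$ be a window, i.e. a relatively compact Borel set with $m_H(\partial W)=0$ (Jordan measurability) and $0<m_H(W)<\infty$, and put $Y_W=\{\Gamma(0,w):w\in W\}\subset\Xi$ (and similarly $Y_{W^\circ}$ for the interior $W^\circ$ of $W$). For a probability preserving Borel $G$-space $(X,\mu)$, a Borel set $Y\subset X$ and $x\in X$ put $Y_x=\{g\in G: g.x\in Y\}$. The triple $(X,\mu,Y)$ is a transverse $G$-space if all sets $Y_x$ are nonempty and locally finite and $\int_X|Y_x\cap K|\,d\mu(x)<\infty$ for all compact $K\subset G$. The transverse measure $\mu_Y$ is the unique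 $\sigma$-finite Borel measure on $Y$ with $$\int_{G\times Y} f\,d(m_G\otimes\mu_Y)=\int_X\sum_{g\in Y_x}f(-g,g.x)\,d\mu(x)$$ for all Borel $f:G\times Y\to[0,\infty]$, and the intensity of $Y$ is $\iota_\mu(Y)=\mu_Y(Y)$. The intersection covolume is $I_\mu(Y)=\iota_{\mu\otimes\mu}(Y^{[2]})$, where $Y^{[2]}=\{(h.y,h.y'):h\in G,\ y,y'\in Y\}$ and $G$ acts on the first coordinate of $X\times X$. Then $(\Xi,\xi,Y_W)$ and $(\Xi\times\Xi,\xi\otimes\xi,Y_W^{[2]})$ are transverse $G$-spaces, each with a unique transverse measure, and: 1. $\iota_\xi(Y_W)=\mathrm{covol}_{G\times H}(\Gamma)^{-1}\cdot m_H(W)$, and $\iota_\xi(Y_{W^\circ})=\iota_\xi(Y_W)$. 2. If $W$ is open or $W-W$ is Jordan measurable (that is, $m_H(\partial(W-W))=0$), then $$\mathrm{covol}_{G\times H}(\Gamma)^{-1}\cdot m_H(W^\circ-W^\circ)\le I_\xi(Y_W)\le \mathrm{covol}_{G\times H}(\Gamma)^{-1}\cdot m_H(W-W).$$ -/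

import Mathlib

open MeasureTheory Set
open scoped ENNReal Pointwise

noncomputable section

/-! ## Borel `G`-spaces, cross sections and transverse measures (additive notation) -/

/-- A Borel action of an additive group `G` on a measurable space `X`. -/
structure BorelAction (G X : Type*) [AddGroup G] [MeasurableSpace G] [MeasurableSpace X] where
  act : G → X → X
  zero_act : ∀ x, act 0 x = x
  add_act : ∀ g h x, act (g + h) x = act g (act h x)
  measurable_act : Measurable fun p : G × X => act p.1 p.2

namespace BorelAction

/-- The action of `G` on `X × X` on the first coordinate: `g • (x, x') = (g • x, x')`. -/
def onFst {G X : Type*} [AddGroup G] [MeasurableSpace G] [MeasurableSpace X]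
    (α : BorelAction G X) : BorelAction G (X × X) where
  act g p := (α.act g p.1, p.2)
  zero_act p := by simp [α.zero_act]
  add_act g h p := by simp [α.add_act]
  measurable_act := by
    refine Measurable.prodMk ?_ (measurable_snd.comp measurable_snd)
    exact α.measurable_act.comp
      (measurable_fst.prodMk (measurable_fst.comp measurable_snd))

end BorelAction

/-- The return times set `Y_x = {g | g • x ∈ Y}`. -/
def returnTimes {G X : Type*} [AddGroup G] [MeasurableSpace G] [MeasurableSpace X]
    (α : BorelAction G X) (Y : Set X) (x : X) : Set G :=
  {g | α.act g x ∈ Y}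

/-- A cross section: a Borel set all of whose return times sets are nonempty and locally finite. -/
structure IsCrossSection {G X : Type*} [AddGroup G] [TopologicalSpace G] [MeasurableSpace G]
    [MeasurableSpace X] (α : BorelAction G X) (Y : Set X) : Prop where
  measurableSet : MeasurableSet Y
  nonempty : ∀ x, (returnTimes α Y x).Nonempty
  locallyFinite : ∀ x, ∀ K : Set G, IsCompact K → (returnTimes α Y x ∩ K).Finite

/-- A transverse `G`-space `(X, μ, Y)`: a probability preserving `G`-space together with a
locally integrable cross section. -/
structure IsTransverseSpace {G X : Type*} [AddGroup G] [TopologicalSpace G] [MeasurableSpace G]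
    [MeasurableSpace X] (α : BorelAction G X) (μ : Measure X) (Y : Set X) : Prop where
  isProbabilityMeasure : IsProbabilityMeasure μ
  measurePreserving : ∀ g, MeasurePreserving (α.act g) μ μ
  isCrossSection : IsCrossSection α Y
  locallyIntegrable : ∀ K : Set G, IsCompact K →
    ∫⁻ x, ((returnTimes α Y x ∩ K).encard : ℝ≥0∞) ∂μ < ∞

/-- The periodization `f_X x = ∑_{g ∈ Y_x} f (g⁻¹, g • x)` of `f : G × Y → [0, ∞]`. -/
def periodization {G X : Type*} [AddGroup G] [MeasurableSpace G] [MeasurableSpace X]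
    (α : BorelAction G X) (Y : Set X) (f : G × Y → ℝ≥0∞) (x : X) : ℝ≥0∞ :=
  ∑' g : returnTimes α Y x, f (-(g : G), ⟨α.act g x, g.2⟩)

/-- `ν` is a transverse measure on `Y`: the Campbell formula `(m ⊗ ν)(f) = μ(f_X)` holds for all
Borel `f : G × Y → [0, ∞]`. Here `m` is the fixed Haar measure of `G`. -/
structure IsTransverseMeasure {G X : Type*} [AddGroup G] [MeasurableSpace G] [MeasurableSpace X]
    (m : Measure G) (α : BorelAction G X) (μ : Measure X) (Y : Set X) (ν : Measure Y) : Prop where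
  sigmaFinite : SigmaFinite ν
  campbell : ∀ f : G × Y → ℝ≥0∞, Measurable f →
    ∫⁻ p, f p ∂(m.prod ν) = ∫⁻ x, periodization α Y f x ∂μ

open Classical in
/-- The transverse measure `μ_Y` (the zero measure if there is none). -/
def transverseMeasure {G X : Type*} [AddGroup G] [MeasurableSpace G] [MeasurableSpace X]
    (m : Measure G) (α : BorelAction G X) (μ : Measure X) (Y : Set X) : Measure Y :=
  if h : ∃ ν, IsTransverseMeasure m α μ Y ν then h.choose else 0

/-- The intensity `ι_μ(Y) = μ_Y(Y)`. -/
def intensity {G X : Type*} [AddGroup G] [MeasurableSpace G] [MeasurableSpace X]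
    (m : Measure G) (α : BorelAction G X) (μ : Measure X) (Y : Set X) : ℝ≥0∞ :=
  transverseMeasure m α μ Y univ

/-- `Y^[2]`, the saturation of `Y × Y` under the diagonal action of `G` on `X × X`. -/
def intersectionSection {G X : Type*} [AddGroup G] [MeasurableSpace G] [MeasurableSpace X]
    (α : BorelAction G X) (Y : Set X) : Set (X × X) :=
  {p | ∃ h : G, ∃ y ∈ Y, ∃ y' ∈ Y, p = (α.act h y, α.act h y')}

/-- The intersection covolume `I_μ(Y) = ι_{μ ⊗ μ}(Y^[2])`, where `G` acts on the first coordinate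
of `X × X`. -/
def intersectionCovolume {G X : Type*} [AddGroup G] [MeasurableSpace G] [MeasurableSpace X]
    (m : Measure G) (α : BorelAction G X) (μ : Measure X) (Y : Set X) : ℝ≥0∞ :=
  intensity m α.onFst (μ.prod μ) (intersectionSection α Y)

/-! ## Lattices, cut-and-project schemes and windows -/

/-- `Γ` is a lattice in the abelian group `A` with Haar measure `m`: a discrete subgroup that
admits a fundamental domain of finite measure. -/
structure IsLattice {A : Type*} [AddCommGroup A] [TopologicalSpace A] [MeasurableSpace A]
    (m : Measure A) (Γ : AddSubgroup A) : Prop where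
  discrete : DiscreteTopology Γ
  finite_covolume : ∃ F : Set A, IsAddFundamentalDomain Γ F m ∧ m F < ∞

/-- An abelian cut-and-project scheme `(G, H; Γ)`. The groups `G` and `H` carry fixed Haar measures
`mG` and `mH`. -/
structure CutAndProjectScheme {G H : Type*}
    [AddCommGroup G] [TopologicalSpace G] [MeasurableSpace G]
    [AddCommGroup H] [TopologicalSpace H] [MeasurableSpace H]
    (mG : Measure G) (mH : Measure H) where
  Γ : AddSubgroup (G × H)
  isLattice : IsLattice (mG.prod mH) Γ
  injOn_fst : InjOn Prod.fst (Γ : Set (G × H))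
  dense_snd : Dense (Prod.snd '' (Γ : Set (G × H)))

/-- Locally compact second countable groups are Polish. -/
theorem polishSpace_of_lcsc (A : Type*) [AddCommGroup A] [TopologicalSpace A]
    [IsTopologicalAddGroup A] [LocallyCompactSpace A] [SecondCountableTopology A] [T2Space A] :
    PolishSpace A := by
  let : UniformSpace A := IsTopologicalAddGroup.rightUniformSpace A
  have : IsUniformAddGroup A := isUniformAddGroup_of_addCommGroup
  have : CompleteSpace A := IsRightUniformAddGroup.completeSpace_of_weaklyLocallyCompactSpace
  have : (uniformity A).IsCountablyGenerated :=
    IsUniformAddGroup.uniformity_countably_generated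
  infer_instance

namespace CutAndProjectScheme

variable {G H : Type*}
  [AddCommGroup G] [TopologicalSpace G] [IsTopologicalAddGroup G] [LocallyCompactSpace G]
  [SecondCountableTopology G] [T2Space G] [MeasurableSpace G] [BorelSpace G]
  [AddCommGroup H] [TopologicalSpace H] [IsTopologicalAddGroup H] [LocallyCompactSpace H]
  [SecondCountableTopology H] [T2Space H] [MeasurableSpace H] [BorelSpace H]
  {mG : Measure G} {mH : Measure H} (S : CutAndProjectScheme mG mH)

/-- The covolume of `Γ` in `G × H`: the measure of a fundamental domain. -/
def covol : ℝ≥0∞ := addCovolume S.Γ (G × H) (mG.prod mH)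

/-- The space `Ξ = Γ \ (G × H)`. -/
abbrev Space : Type _ := (G × H) ⧸ S.Γ

instance instIsClosed : IsClosed (S.Γ : Set (G × H)) := by
  have := S.isLattice.discrete
  exact AddSubgroup.isClosed_of_discrete

instance instBorelSpace : BorelSpace S.Space := by
  have := polishSpace_of_lcsc G
  have := polishSpace_of_lcsc H
  exact QuotientAddGroup.borelSpace

/-- The Haar probability measure `ξ` on `Ξ`. -/
def haarProb : Measure S.Space :=
  ((Measure.addHaar : Measure S.Space) univ)⁻¹ • Measure.addHaar

/-- The action of `G` on `Ξ`: `g₀ • Γ(g, h) = Γ(g - g₀, h)`. -/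
def action : BorelAction G S.Space where
  act g₀ x := x + QuotientAddGroup.mk (-g₀, 0)
  zero_act x := by
    have : ((-0, 0) : G × H) = 0 := by simp
    rw [this, QuotientAddGroup.mk_zero, add_zero]
  add_act g h x := by
    have : ((-(g + h), 0) : G × H) = (-h, 0) + (-g, 0) := by simp
    rw [this, QuotientAddGroup.mk_add, add_assoc]
  measurable_act := by
    apply Continuous.measurable
    exact continuous_snd.add
      (QuotientAddGroup.continuous_mk.comp (continuous_fst.neg.prodMk continuous_const))

/-- The cross section `Y_W = {Γ(0, w) | w ∈ W}`. -/
def crossSection (W : Set H) : Set S.Space :=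
  (fun w : H => (QuotientAddGroup.mk ((0 : G), w) : S.Space)) '' W

end CutAndProjectScheme

/-- Jordan measurability: the topological boundary is a null set. -/
def IsJordanMeasurable {H : Type*} [TopologicalSpace H] [MeasurableSpace H] (m : Measure H)
    (W : Set H) : Prop :=
  m (frontier W) = 0

/-- A window: a relatively compact Jordan measurable Borel set with `0 < m(W) < ∞`. -/
structure IsWindow {H : Type*} [TopologicalSpace H] [MeasurableSpace H] (m : Measure H)
    (W : Set H) : Prop where
  measurableSet : MeasurableSet W
  relativelyCompact : IsCompact (closure W)
  jordan : IsJordanMeasurable m W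
  measure_pos : 0 < m W
  measure_lt_top : m W < ∞

end

/-! A return time of `Γ(g, h)` to `Y_D` is a point `g + γ.1` with `h + γ.2 ∈ D`. Injectivity of the
projection to `G` makes `γ` unique, so a sum over return times is a sum over `Γ`
(`tsum_returnTimes`). Unfolding against a fundamental domain (`lintegral_haarProb`) then shows that
the transverse measure of `Y_D` is `covol⁻¹ • mH|_D` carried to `Ξ`, which gives the intensity.
Density of the projection to `H` yields nonempty return times, discreteness of `Γ` yields locally
finite ones.

For `Y_W^[2]`, the key is the difference `x' - x`. It lies in `Y_{W-W}` whenever `(x, x') ∈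
Y_W^[2]`; conversely, if `U ⊆ W` is open and `x' - x ∈ Y_{U-U}`, density places `(x, x')` in
`Y_W^[2]`. In the coordinates `(x' - x, x')`, which preserve `ξ ⊗ ξ`, moving `x` by `g` moves the
difference by `-g`. Hence for Borel `D ⊇ W - W` of finite measure the transverse measure of
`Y_W^[2]` is the image of `(sectionMeasure D) ⊗ ξ`, restricted to `Y_W^[2]`
(`isTransverseMeasure_intersectionSection`). Its total mass lies between `covol⁻¹ * mH (U - U)` and
`covol⁻¹ * mH D`; take `U` to be the interior of `W` and `D` a measurable hull of `W - W`. -/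

section Transverse

/-! ### Uniqueness and construction of transverse measures for general Borel actions. -/

set_option linter.unusedSectionVars false

variable {G X : Type*} [AddGroup G] [TopologicalSpace G] [IsTopologicalAddGroup G]
  [LocallyCompactSpace G] [SecondCountableTopology G] [T2Space G] [MeasurableSpace G]
  [BorelSpace G] [MeasurableSpace X] {m : Measure G} [m.IsAddHaarMeasure]
  {α : BorelAction G X} {μ : Measure X} {Y : Set X}

theorem IsTransverseMeasure.unique {ν ν' : Measure Y} (h : IsTransverseMeasure m α μ Y ν)
    (h' : IsTransverseMeasure m α μ Y ν') : ν = ν' := by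
  have := h.sigmaFinite
  have := h'.sigmaFinite
  -- Campbell's formula for the indicator of `K × B` fixes `m K * ν B`, and `0 < m K < ∞` allows
  -- cancelling.
  obtain ⟨K, hK, hK0⟩ := exists_compact_mem_nhds (0 : G)
  have hKm : MeasurableSet K := hK.isClosed.measurableSet
  ext B hB
  have key : m K * ν B = m K * ν' B := by
    rw [← Measure.prod_prod, ← Measure.prod_prod, ← lintegral_indicator_one (hKm.prod hB),
      ← lintegral_indicator_one (hKm.prod hB),
      h.campbell _ (measurable_one.indicator (hKm.prod hB)),
      h'.campbell _ (measurable_one.indicator (hKm.prod hB))]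
  exact (ENNReal.mul_right_inj (m.measure_pos_of_mem_nhds hK0).ne' hK.measure_lt_top.ne).1 key

theorem IsTransverseMeasure.intensity_eq {ν : Measure Y} (h : IsTransverseMeasure m α μ Y ν) :
    intensity m α μ Y = ν univ := by
  have hex : ∃ ν, IsTransverseMeasure m α μ Y ν := ⟨ν, h⟩
  rw [intensity, transverseMeasure, dif_pos hex, hex.choose_spec.unique h]

theorem IsTransverseMeasure.existsUnique {ν : Measure Y} (h : IsTransverseMeasure m α μ Y ν) :
    ∃! ν, IsTransverseMeasure m α μ Y ν :=
  ⟨ν, h, fun _ h' => h'.unique h⟩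

/-- A measure on `X` that is concentrated on `Y` and satisfies the Campbell formula for functions
on `G × X` restricts to a transverse measure. -/
theorem isTransverseMeasure_comap (hY : MeasurableSet Y) (lam : Measure X) [IsFiniteMeasure lam]
    (h0 : lam Yᶜ = 0)
    (h : ∀ F : G × X → ℝ≥0∞, Measurable F → ∫⁻ p, F p ∂(m.prod lam) =
      ∫⁻ x, ∑' g : returnTimes α Y x, F (-(g : G), α.act g x) ∂μ) :
    IsTransverseMeasure m α μ Y (lam.comap (↑)) := by
  have hsub : MeasurableEmbedding ((↑) : Y → X) := MeasurableEmbedding.subtype_coe hY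
  have hs : IsFiniteMeasure (lam.comap ((↑) : Y → X)) :=
    ⟨by rw [hsub.comap_apply]; exact measure_lt_top _ _⟩
  refine ⟨inferInstance, fun f hf => ?_⟩
  have he : MeasurableEmbedding (Prod.map id ((↑) : Y → X) : G × Y → G × X) :=
    MeasurableEmbedding.id.prodMap hsub
  -- Extension by zero off `G × Y`; the value there is irrelevant, since `lam` lives on `Y`.
  set F : G × X → ℝ≥0∞ := Function.extend (Prod.map id ((↑) : Y → X)) f 0 with hF
  have hFe : ∀ p, F (Prod.map id ((↑) : Y → X) p) = f p := fun p => he.injective.extend_apply _ _ _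
  have hFm : Measurable F := he.measurable_extend hf measurable_const
  have hlam : lam.restrict Y = lam := Measure.restrict_eq_self_of_ae_mem (by
    rw [ae_iff]; exact h0)
  calc ∫⁻ p, f p ∂(m.prod (lam.comap (↑)))
      = ∫⁻ p, F (Prod.map id ((↑) : Y → X) p) ∂(m.prod (lam.comap (↑))) := by simp_rw [hFe]
    _ = ∫⁻ p, F p ∂(m.prod lam) := by
        rw [← he.lintegral_map, ← Measure.map_prod_map _ _ measurable_id hsub.measurable,
          Measure.map_id, hsub.map_comap, Subtype.range_coe, hlam]
    _ = ∫⁻ x, periodization α Y f x ∂μ := by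
        rw [h F hFm]
        refine lintegral_congr fun x => tsum_congr fun g => ?_
        exact hFe (-(g : G), ⟨α.act g x, g.2⟩)

theorem IsTransverseMeasure.lintegral_encard_lt_top {ν : Measure Y}
    (h : IsTransverseMeasure m α μ Y ν) (hν : ν univ < ∞) {K : Set G} (hK : IsCompact K) :
    ∫⁻ x, ((returnTimes α Y x ∩ K).encard : ℝ≥0∞) ∂μ < ∞ := by
  have := h.sigmaFinite
  -- The set is `-K` because the periodization evaluates its function at `-g`.
  have hKm : MeasurableSet (-K) := hK.neg.isClosed.measurableSet
  have hc := h.campbell _ (measurable_one.indicator (hKm.prod (MeasurableSet.univ (α := Y))))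
  rw [lintegral_indicator_one (hKm.prod MeasurableSet.univ), Measure.prod_prod] at hc
  have heq : ∀ x, ((returnTimes α Y x ∩ K).encard : ℝ≥0∞) =
      periodization α Y (((-K) ×ˢ univ).indicator 1) x := by
    intro x
    rw [periodization, ← ENNReal.tsum_set_one,
      tsum_subtype (returnTimes α Y x ∩ K) (fun _ => (1 : ℝ≥0∞))]
    have : ∀ g : returnTimes α Y x,
        ((-K) ×ˢ (univ : Set Y)).indicator (1 : G × Y → ℝ≥0∞) (-(g : G), ⟨α.act g x, g.2⟩) =
          K.indicator (fun _ => 1) (g : G) := by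
      intro g
      by_cases hg : (g : G) ∈ K <;> simp [hg]
    rw [tsum_congr this, tsum_subtype (returnTimes α Y x) (K.indicator fun _ => (1 : ℝ≥0∞)),
      indicator_indicator]
  simp_rw [heq]
  rw [← hc]
  exact ENNReal.mul_lt_top hK.neg.measure_lt_top hν

end Transverse

namespace CutAndProjectScheme

set_option linter.unusedSectionVars false

variable {G H : Type*}
  [AddCommGroup G] [TopologicalSpace G] [IsTopologicalAddGroup G] [LocallyCompactSpace G]
  [SecondCountableTopology G] [T2Space G] [MeasurableSpace G] [BorelSpace G]
  [AddCommGroup H] [TopologicalSpace H] [IsTopologicalAddGroup H] [LocallyCompactSpace H]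
  [SecondCountableTopology H] [T2Space H] [MeasurableSpace H] [BorelSpace H]
  {mG : Measure G} {mH : Measure H} [mG.IsAddHaarMeasure] [mH.IsAddHaarMeasure]
  (S : CutAndProjectScheme mG mH)

/-! ### Fundamental domains, the Haar probability measure and unfolding. -/

theorem countable_lattice : Countable S.Γ := by
  have := S.isLattice.discrete
  exact countable_of_Lindelof_of_discrete

theorem exists_fundamentalDomain :
    ∃ F : Set (G × H), IsAddFundamentalDomain S.Γ F (mG.prod mH) ∧
      (mG.prod mH) F = S.covol ∧ S.covol ≠ 0 ∧ S.covol ≠ ∞ := by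
  obtain ⟨F, hF, hFt⟩ := S.isLattice.finite_covolume
  have := S.countable_lattice
  have hc : S.covol = (mG.prod mH) F := hF.covolume_eq_volume
  refine ⟨F, hF, hc.symm, fun h0 => ?_, hc ▸ hFt.ne⟩
  -- A null fundamental domain would make every invariant set null, including the whole group.
  have := hF.measure_zero_of_invariant univ (fun g => by simp) (by rw [univ_inter, ← hc, h0])
  exact isOpen_univ.measure_ne_zero (mG.prod mH) univ_nonempty this

theorem covol_ne_zero : S.covol ≠ 0 := S.exists_fundamentalDomain.choose_spec.2.2.1

theorem covol_ne_top : S.covol ≠ ∞ := S.exists_fundamentalDomain.choose_spec.2.2.2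

theorem inv_covol_ne_top : S.covol⁻¹ ≠ ∞ := ENNReal.inv_ne_top.2 S.covol_ne_zero

theorem measurable_mk : Measurable (QuotientAddGroup.mk : G × H → S.Space) :=
  QuotientAddGroup.measurable_from_quotient.1 measurable_id

/-- The pushforward of the measure on `F` is translation invariant: a translate of `F` is again a
fundamental domain, and all of them give `Γ`-invariant sets the same mass. Uniqueness of Haar
measure on `Ξ` leaves a scalar, fixed by the total mass `covol`. -/
theorem haarProb_eq_map {F : Set (G × H)} (hF : IsAddFundamentalDomain S.Γ F (mG.prod mH))
    (hFc : (mG.prod mH) F = S.covol) :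
    S.haarProb = S.covol⁻¹ •
      Measure.map (QuotientAddGroup.mk : G × H → S.Space) ((mG.prod mH).restrict F) := by
  have := S.countable_lattice
  set ρ : Measure S.Space := Measure.map QuotientAddGroup.mk ((mG.prod mH).restrict F) with hρ
  have hρu : ρ univ = S.covol := by
    rw [hρ, Measure.map_apply S.measurable_mk MeasurableSet.univ, preimage_univ,
      Measure.restrict_apply_univ, hFc]
  have : IsFiniteMeasure ρ := ⟨by rw [hρu]; exact S.covol_ne_top.lt_top⟩
  have : ρ.IsAddLeftInvariant := by
    refine ⟨fun x => ?_⟩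
    obtain ⟨a, rfl⟩ := QuotientAddGroup.mk_surjective x
    ext A hA
    rw [Measure.map_apply (measurable_const_add _) hA,
      hρ, Measure.map_apply S.measurable_mk hA,
      Measure.map_apply S.measurable_mk (measurable_const_add _ hA),
      Measure.restrict_apply (S.measurable_mk hA),
      Measure.restrict_apply (S.measurable_mk (measurable_const_add _ hA)),
      hF.measure_set_eq (hF.vadd_of_comm a) (S.measurable_mk hA),
      ← measure_preimage_add (mG.prod mH) a (_ ∩ (a +ᵥ F))]
    · congr 1
      ext p
      simp [mem_vadd_set_iff_neg_vadd_mem]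
    · intro γ
      ext p
      have : (QuotientAddGroup.mk (γ +ᵥ p) : S.Space) = QuotientAddGroup.mk p :=
        (QuotientAddGroup.eq.2 (by
          have : -(γ +ᵥ p) + p = -(γ : G × H) := by
            rw [AddSubgroup.vadd_def, vadd_eq_add]; abel
          rw [this]; exact S.Γ.neg_mem γ.2))
      simp only [mem_preimage]
      rw [this]
  have hsm := Measure.isAddLeftInvariant_eq_smul ρ (Measure.addHaar : Measure S.Space)
  set c := ρ.addHaarScalarFactor (Measure.addHaar : Measure S.Space)
  set A := (Measure.addHaar : Measure S.Space) univ with hA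
  have hcA : S.covol = c * A := by
    rw [← hρu, hsm, Measure.smul_apply]; rfl
  have hA0 : A ≠ 0 := isOpen_univ.measure_ne_zero _ univ_nonempty
  have hc0 : (c : ℝ≥0∞) ≠ 0 := by
    intro h; apply S.covol_ne_zero; rw [hcA, h, zero_mul]
  rw [hsm, haarProb, ← hA, hcA]
  have : (c • (Measure.addHaar : Measure S.Space)) = (c : ℝ≥0∞) • Measure.addHaar := rfl
  rw [this, smul_smul]
  congr 1
  rw [ENNReal.mul_inv (Or.inl hc0) (Or.inl ENNReal.coe_ne_top), mul_comm, ← mul_assoc,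
    ENNReal.mul_inv_cancel hc0 ENNReal.coe_ne_top, one_mul]

instance instIsProbabilityMeasure : IsProbabilityMeasure S.haarProb := by
  obtain ⟨F, hF, hFc, h0, ht⟩ := S.exists_fundamentalDomain
  refine ⟨?_⟩
  rw [S.haarProb_eq_map hF hFc, Measure.smul_apply,
    Measure.map_apply S.measurable_mk MeasurableSet.univ, preimage_univ,
    Measure.restrict_apply_univ, hFc, smul_eq_mul, ENNReal.inv_mul_cancel h0 ht]

instance instIsAddLeftInvariant : S.haarProb.IsAddLeftInvariant := by
  unfold haarProb; infer_instance

/-- The unfolding formula. -/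
theorem lintegral_haarProb {φ : G × H → ℝ≥0∞} (hφ : Measurable φ) {ψ : S.Space → ℝ≥0∞}
    (h : ∀ p : G × H, ψ (QuotientAddGroup.mk p) = ∑' γ : S.Γ, φ (γ +ᵥ p)) :
    ∫⁻ x, ψ x ∂S.haarProb = S.covol⁻¹ * ∫⁻ p, φ p ∂(mG.prod mH) := by
  have := S.countable_lattice
  obtain ⟨F, hF, hFc, -, -⟩ := S.exists_fundamentalDomain
  have hm : ∀ γ : S.Γ, Measurable fun p : G × H => φ (γ +ᵥ p) := fun γ =>
    hφ.comp (measurable_const_vadd γ)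
  have hψ : Measurable ψ := by
    refine QuotientAddGroup.measurable_from_quotient.2 ?_
    have : ψ ∘ QuotientAddGroup.mk = fun p => ∑' γ : S.Γ, φ (γ +ᵥ p) := funext h
    rw [this]
    exact Measurable.tsum hm
  rw [S.haarProb_eq_map hF hFc, lintegral_smul_measure, lintegral_map hψ S.measurable_mk,
    hF.lintegral_eq_tsum'' φ, ← lintegral_tsum fun γ => (hm γ).aemeasurable]
  simp_rw [h]
  rfl

/-! ### The sections `Y_D`: return times, transverse measure, intensity. -/

theorem action_mk (g : G) (p : G × H) :
    S.action.act g (QuotientAddGroup.mk p) = QuotientAddGroup.mk (p.1 - g, p.2) := by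
  change (QuotientAddGroup.mk p : S.Space) + QuotientAddGroup.mk (-g, 0) = _
  rw [← QuotientAddGroup.mk_add]
  congr 1
  ext <;> simp [sub_eq_add_neg]

theorem mk_eq_mk_iff {p q : G × H} :
    (QuotientAddGroup.mk p : S.Space) = QuotientAddGroup.mk q ↔ q - p ∈ S.Γ := by
  rw [QuotientAddGroup.eq, neg_add_eq_sub]

theorem mk_mem_crossSection {D : Set H} {p : G × H} :
    (QuotientAddGroup.mk p : S.Space) ∈ S.crossSection D ↔
      ∃ γ ∈ S.Γ, p.1 + γ.1 = 0 ∧ p.2 + γ.2 ∈ D := by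
  constructor
  · rintro ⟨w, hw, h⟩
    refine ⟨(0, w) - p, S.mk_eq_mk_iff.1 h.symm, by simp, by simpa using hw⟩
  · rintro ⟨γ, hγ, h1, h2⟩
    refine ⟨p.2 + γ.2, h2, (S.mk_eq_mk_iff.2 ?_).symm⟩
    convert hγ using 1
    ext
    · simpa using (eq_neg_of_add_eq_zero_right h1).symm
    · simp

theorem mem_returnTimes_mk {D : Set H} {p : G × H} {g : G} :
    g ∈ returnTimes S.action (S.crossSection D) (QuotientAddGroup.mk p) ↔
      ∃ γ ∈ S.Γ, g = p.1 + γ.1 ∧ p.2 + γ.2 ∈ D := by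
  rw [returnTimes, mem_ofPred_eq, S.action_mk, S.mk_mem_crossSection]
  refine exists_congr fun γ => and_congr_right fun _ => and_congr_left fun _ => ?_
  constructor
  · intro h
    rw [← sub_eq_zero, ← neg_eq_zero, ← h]; simp only; abel
  · rintro rfl; simp only; abel

theorem eq_of_fst_eq {γ γ' : G × H} (h : γ ∈ S.Γ) (h' : γ' ∈ S.Γ) (he : γ.1 = γ'.1) : γ = γ' :=
  S.injOn_fst h h' he

/-- Turns the periodization over return times into one over `Γ`, the form required by
`lintegral_haarProb`. The map `γ ↦ p.1 + γ.1` is a bijection from the relevant lattice points to the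
return times, because `γ.1` determines `γ`. -/
theorem tsum_returnTimes (D : Set H) (F : G × S.Space → ℝ≥0∞) (p : G × H) :
    ∑' g : returnTimes S.action (S.crossSection D) (QuotientAddGroup.mk p),
      F (-(g : G), S.action.act g (QuotientAddGroup.mk p)) =
    ∑' γ : S.Γ, {q : G × H | q.2 ∈ D}.indicator
      (fun q => F (-q.1, QuotientAddGroup.mk (0, q.2))) (γ +ᵥ p) := by
  let T : Set S.Γ := {γ | p.2 + (γ : G × H).2 ∈ D}
  let e : T → returnTimes S.action (S.crossSection D) (QuotientAddGroup.mk p) :=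
    fun γ => ⟨p.1 + (γ : G × H).1, S.mem_returnTimes_mk.2 ⟨γ, γ.1.2, rfl, γ.2⟩⟩
  have he : Function.Bijective e := by
    constructor
    · intro γ γ' h
      have : p.1 + (γ : G × H).1 = p.1 + (γ' : G × H).1 := congrArg Subtype.val h
      exact Subtype.ext (Subtype.ext (S.eq_of_fst_eq γ.1.2 γ'.1.2 (add_left_cancel this)))
    · rintro ⟨g, hg⟩
      obtain ⟨γ, hγ, rfl, h2⟩ := S.mem_returnTimes_mk.1 hg
      exact ⟨⟨⟨γ, hγ⟩, h2⟩, rfl⟩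
  rw [← (Equiv.ofBijective e he).tsum_eq]
  have hr : ∀ γ : S.Γ, {q : G × H | q.2 ∈ D}.indicator
      (fun q => F (-q.1, QuotientAddGroup.mk (0, q.2))) (γ +ᵥ p) =
      T.indicator (fun γ => F (-(p.1 + (γ : G × H).1),
        QuotientAddGroup.mk (0, p.2 + (γ : G × H).2))) γ := by
    intro γ
    have h1 : (γ +ᵥ p).1 = p.1 + (γ : G × H).1 := add_comm _ _
    have h2 : (γ +ᵥ p).2 = p.2 + (γ : G × H).2 := add_comm _ _
    have h3 : γ +ᵥ p ∈ {q : G × H | q.2 ∈ D} ↔ γ ∈ T := by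
      rw [mem_ofPred_eq, h2]; rfl
    by_cases h : γ ∈ T
    · rw [indicator_of_mem h, indicator_of_mem (h3.2 h), h1, h2]
    · rw [indicator_of_notMem h, indicator_of_notMem (h3.not.2 h)]
  simp_rw [hr]
  rw [← tsum_subtype]
  refine tsum_congr fun γ => ?_
  have : S.action.act (p.1 + (γ : G × H).1) (QuotientAddGroup.mk p) =
      QuotientAddGroup.mk (0, p.2 + (γ : G × H).2) := by
    rw [S.action_mk, S.mk_eq_mk_iff]
    convert γ.1.2 using 1
    ext
    · simp
    · simp
  simp only [Equiv.ofBijective_apply, e, this]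

theorem continuous_mk_zero : Continuous fun h : H => (QuotientAddGroup.mk ((0 : G), h) : S.Space) :=
  QuotientAddGroup.continuous_mk.comp (continuous_const.prodMk continuous_id)

/-- The measure `covol⁻¹ • m_H|_D`, transported to `Ξ`. -/
noncomputable def sectionMeasure (D : Set H) : Measure S.Space :=
  S.covol⁻¹ • Measure.map (fun h : H => (QuotientAddGroup.mk ((0 : G), h) : S.Space))
    (mH.restrict D)

theorem sectionMeasure_univ (D : Set H) : S.sectionMeasure D univ = S.covol⁻¹ * mH D := by
  simp [sectionMeasure, Measure.map_apply S.continuous_mk_zero.measurable MeasurableSet.univ]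

theorem isFiniteMeasure_sectionMeasure {D : Set H} (hDt : mH D < ∞) :
    IsFiniteMeasure (S.sectionMeasure D) :=
  ⟨by rw [sectionMeasure_univ]; exact ENNReal.mul_lt_top S.inv_covol_ne_top.lt_top hDt⟩

theorem lintegral_prod_sectionMeasure (D : Set H) {F : G × S.Space → ℝ≥0∞} (hF : Measurable F) :
    ∫⁻ p, F p ∂(mG.prod (S.sectionMeasure D)) =
      S.covol⁻¹ * ∫⁻ p, F (p.1, QuotientAddGroup.mk ((0 : G), p.2)) ∂(mG.prod (mH.restrict D)) := by
  have hmk := S.continuous_mk_zero.measurable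
  have := Measure.map_prod_map mG (mH.restrict D) measurable_id hmk
  rw [Measure.map_id] at this
  rw [sectionMeasure, Measure.prod_smul_right, lintegral_smul_measure, smul_eq_mul,
    this, lintegral_map hF (measurable_id.prodMap hmk)]
  rfl

theorem lintegral_tsum_returnTimes {D : Set H} (hD : MeasurableSet D)
    {F : G × S.Space → ℝ≥0∞} (hF : Measurable F) :
    ∫⁻ x, ∑' g : returnTimes S.action (S.crossSection D) x, F (-(g : G), S.action.act g x)
      ∂S.haarProb =
    ∫⁻ p, F p ∂(mG.prod (S.sectionMeasure D)) := by
  rw [S.lintegral_prod_sectionMeasure D hF]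
  have hmk := S.continuous_mk_zero.measurable
  have hmeas : Measurable fun p : G × H => F (p.1, QuotientAddGroup.mk ((0 : G), p.2)) :=
    hF.comp (measurable_fst.prodMk (hmk.comp measurable_snd))
  -- Absorbs the sign of `-g` in the Campbell formula: Haar measure on `G` is invariant under
  -- negation.
  have hneg : MeasurePreserving (Prod.map Neg.neg id : G × H → G × H)
      (mG.prod (mH.restrict D)) (mG.prod (mH.restrict D)) :=
    (Measure.measurePreserving_neg mG).prod (MeasurePreserving.id _)
  have hDm : MeasurableSet {q : G × H | q.2 ∈ D} := measurable_snd hD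
  rw [S.lintegral_haarProb ((hmeas.comp hneg.measurable).indicator hDm)
    fun p => S.tsum_returnTimes D F p, lintegral_indicator hDm]
  have hres : (mG.prod mH).restrict {q : G × H | q.2 ∈ D} = mG.prod (mH.restrict D) := by
    rw [← Measure.restrict_univ (μ := mG), Measure.prod_restrict, Measure.restrict_univ, univ_prod]
    rfl
  rw [hres, ← hneg.lintegral_comp hmeas]
  rfl

theorem injective_mk_zero :
    Function.Injective fun h : H => (QuotientAddGroup.mk ((0 : G), h) : S.Space) := by
  intro h h' he
  have := S.mk_eq_mk_iff.1 he
  have := S.eq_of_fst_eq this S.Γ.zero_mem (by simp)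
  simpa [sub_eq_zero, eq_comm] using congrArg Prod.snd this

theorem measurableSet_crossSection {D : Set H} (hD : MeasurableSet D) :
    MeasurableSet (S.crossSection D) := by
  have := polishSpace_of_lcsc H
  exact hD.image_of_continuousOn_injOn S.continuous_mk_zero.continuousOn
    S.injective_mk_zero.injOn

theorem isTransverseMeasure_crossSection {D : Set H} (hD : MeasurableSet D) (hDt : mH D < ∞) :
    IsTransverseMeasure mG S.action S.haarProb (S.crossSection D)
      ((S.sectionMeasure D).comap (↑)) := by
  have := S.isFiniteMeasure_sectionMeasure hDt
  have hmk := S.continuous_mk_zero.measurable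
  have hY := S.measurableSet_crossSection hD
  refine isTransverseMeasure_comap hY _ ?_ fun F hF => ?_
  · rw [sectionMeasure, Measure.smul_apply, Measure.map_apply hmk hY.compl,
      Measure.restrict_apply (hmk hY.compl), smul_eq_mul]
    have : (fun h : H => (QuotientAddGroup.mk ((0 : G), h) : S.Space)) ⁻¹' (S.crossSection D)ᶜ ∩ D
        = ∅ := by
      ext h
      simp only [mem_inter_iff, mem_preimage, mem_compl_iff, mem_empty_iff_false, iff_false]
      rintro ⟨h1, h2⟩
      exact h1 ⟨h, h2, rfl⟩
    rw [this, measure_empty, mul_zero]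
  · rw [S.lintegral_tsum_returnTimes hD hF]

theorem intensity_crossSection {D : Set H} (hD : MeasurableSet D) (hDt : mH D < ∞) :
    intensity mG S.action S.haarProb (S.crossSection D) = S.covol⁻¹ * mH D := by
  have hY := S.measurableSet_crossSection hD
  have h := S.isTransverseMeasure_crossSection hD hDt
  rw [h.intensity_eq, (MeasurableEmbedding.subtype_coe hY).comap_apply, image_univ,
    Subtype.range_coe, sectionMeasure, Measure.smul_apply,
    Measure.map_apply S.continuous_mk_zero.measurable hY,
    Measure.restrict_apply (S.continuous_mk_zero.measurable hY), smul_eq_mul,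
    crossSection, preimage_image_eq _ S.injective_mk_zero, inter_self]

theorem exists_mem_lattice {U : Set H} (hU : IsOpen U) (hne : U.Nonempty) (v : H) :
    ∃ γ ∈ S.Γ, v + γ.2 ∈ U := by
  obtain ⟨u, hu⟩ := hne
  obtain ⟨_, ht, γ, hγ, rfl⟩ := S.dense_snd.inter_open_nonempty ((fun t => v + t) ⁻¹' U)
    (hU.preimage (continuous_const_add v)) ⟨-v + u, by simpa using hu⟩
  exact ⟨γ, hγ, ht⟩

theorem returnTimes_nonempty {U D : Set H} (hU : IsOpen U) (hne : U.Nonempty) (hUD : U ⊆ D)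
    (x : S.Space) : (returnTimes S.action (S.crossSection D) x).Nonempty := by
  obtain ⟨p, rfl⟩ := QuotientAddGroup.mk_surjective x
  obtain ⟨γ, hγ, h⟩ := S.exists_mem_lattice hU hne p.2
  exact ⟨p.1 + γ.1, S.mem_returnTimes_mk.2 ⟨γ, hγ, rfl, hUD h⟩⟩

theorem finite_lattice_inter {C : Set (G × H)} (hC : IsCompact C) :
    ((S.Γ : Set (G × H)) ∩ C).Finite := by
  have := S.isLattice.discrete
  have hd : IsDiscrete (S.Γ : Set (G × H)) := ⟨this⟩
  exact (hC.inter_left S.instIsClosed).finite (hd.mono inter_subset_left)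

theorem returnTimes_inter_finite {C D : Set H} (hC : IsCompact C) (hDC : D ⊆ C) (x : S.Space)
    {K : Set G} (hK : IsCompact K) :
    (returnTimes S.action (S.crossSection D) x ∩ K).Finite := by
  obtain ⟨p, rfl⟩ := QuotientAddGroup.mk_surjective x
  have hcpt : IsCompact ((fun q => -p + q) '' (K ×ˢ C)) :=
    (hK.prod hC).image (continuous_const_add _)
  refine ((S.finite_lattice_inter hcpt).image fun γ => p.1 + γ.1).subset ?_
  rintro g ⟨hg, hgK⟩
  obtain ⟨γ, hγ, rfl, hD⟩ := S.mem_returnTimes_mk.1 hg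
  exact ⟨γ, ⟨hγ, p + γ, ⟨hgK, hDC hD⟩, by simp⟩, rfl⟩

theorem measurePreserving_action (g : G) :
    MeasurePreserving (S.action.act g) S.haarProb S.haarProb :=
  measurePreserving_add_right S.haarProb (QuotientAddGroup.mk (-g, 0))

theorem isTransverseSpace_crossSection {U C D : Set H} (hU : IsOpen U) (hne : U.Nonempty)
    (hUD : U ⊆ D) (hD : MeasurableSet D) (hC : IsCompact C) (hDC : D ⊆ C) :
    IsTransverseSpace S.action S.haarProb (S.crossSection D) where
  isProbabilityMeasure := inferInstance
  measurePreserving := S.measurePreserving_action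
  isCrossSection :=
    { measurableSet := S.measurableSet_crossSection hD
      nonempty := S.returnTimes_nonempty hU hne hUD
      locallyFinite := fun x _ hK => S.returnTimes_inter_finite hC hDC x hK }
  locallyIntegrable := fun K hK => by
    have hDt : mH D < ∞ := (measure_mono hDC).trans_lt hC.measure_lt_top
    have := S.isFiniteMeasure_sectionMeasure hDt
    refine (S.isTransverseMeasure_crossSection hD hDt).lintegral_encard_lt_top ?_ hK
    rw [(MeasurableEmbedding.subtype_coe (S.measurableSet_crossSection hD)).comap_apply]
    exact measure_lt_top _ _

/-! ### The intersection section: measurability and description by differences. -/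

theorem mem_intersectionSection {W : Set H} {q : S.Space × S.Space} :
    q ∈ intersectionSection S.action (S.crossSection W) ↔
      ∃ u : G, ∃ w ∈ W, ∃ w' ∈ W,
        q = (QuotientAddGroup.mk (u, w), QuotientAddGroup.mk (u, w')) := by
  constructor
  · rintro ⟨h, _, ⟨w, hw, rfl⟩, _, ⟨w', hw', rfl⟩, rfl⟩
    exact ⟨0 - h, w, hw, w', hw', by rw [S.action_mk, S.action_mk]⟩
  · rintro ⟨u, w, hw, w', hw', rfl⟩
    refine ⟨-u, _, ⟨w, hw, rfl⟩, _, ⟨w', hw', rfl⟩, ?_⟩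
    simp only [S.action_mk, zero_sub, neg_neg]

theorem exists_countable_injOn_cover :
    ∃ 𝓑 : Set (Set (G × H)), 𝓑.Countable ∧ (∀ B ∈ 𝓑, IsOpen B) ∧ ⋃₀ 𝓑 = univ ∧
      ∀ B ∈ 𝓑, InjOn (QuotientAddGroup.mk : G × H → S.Space) B := by
  have hb := TopologicalSpace.isBasis_countableBasis (G × H)
  refine ⟨{B ∈ TopologicalSpace.countableBasis (G × H) |
    InjOn (QuotientAddGroup.mk : G × H → S.Space) B},
    (TopologicalSpace.countable_countableBasis _).mono (sep_subset _ _),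
    fun B hB => hb.isOpen hB.1, ?_, fun B hB => hB.2⟩
  refine eq_univ_of_forall fun p => ?_
  have := S.isLattice.discrete
  obtain ⟨V, hV, hV0⟩ := isOpen_induced_iff.1 (isOpen_discrete ({0} : Set S.Γ))
  have h0 : (0 : G × H) ∈ V := by
    have : (0 : S.Γ) ∈ (Subtype.val ⁻¹' V : Set S.Γ) := by rw [hV0]; rfl
    exact this
  have hc : Continuous fun q : (G × H) × (G × H) => q.2 - q.1 := continuous_snd.sub continuous_fst
  have hN : (fun q : (G × H) × (G × H) => q.2 - q.1) ⁻¹' V ∈ nhds (p, p) :=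
    (hV.preimage hc).mem_nhds (by simpa using h0)
  rw [nhds_prod_eq, Filter.mem_prod_same_iff] at hN
  obtain ⟨N, hN, hNV⟩ := hN
  obtain ⟨B, hB, hpB, hBN⟩ := hb.mem_nhds_iff.1 hN
  refine ⟨B, ⟨hB, fun a ha b hb hab => ?_⟩, hpB⟩
  have hm := S.mk_eq_mk_iff.1 hab
  have : (⟨b - a, hm⟩ : S.Γ) ∈ (Subtype.val ⁻¹' V : Set S.Γ) := hNV (mk_mem_prod (hBN ha) (hBN hb))
  rw [hV0] at this
  have : b - a = 0 := congrArg Subtype.val (mem_singleton_iff.1 this)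
  exact (sub_eq_zero.1 this).symm

/-- The section is the image of `G × W × W` under a continuous map that need not be injective. On
each of countably many pieces where the quotient map is injective it is, so the Lusin–Souslin
theorem applies piecewise. -/
theorem measurableSet_intersectionSection {W : Set H} (hW : MeasurableSet W) :
    MeasurableSet (intersectionSection S.action (S.crossSection W)) := by
  have := polishSpace_of_lcsc G
  have := polishSpace_of_lcsc H
  obtain ⟨𝓑, h𝓑c, h𝓑o, h𝓑u, h𝓑i⟩ := S.exists_countable_injOn_cover
  let f : (G × H) × H → S.Space × S.Space := fun q =>
    (QuotientAddGroup.mk q.1, QuotientAddGroup.mk (q.1.1, q.2))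
  have hf : Continuous f :=
    (QuotientAddGroup.continuous_mk.comp continuous_fst).prodMk
      (QuotientAddGroup.continuous_mk.comp
        ((continuous_fst.comp continuous_fst).prodMk continuous_snd))
  have hZ : intersectionSection S.action (S.crossSection W) =
      ⋃ B ∈ 𝓑, f '' ((B ∩ univ ×ˢ W) ×ˢ W) := by
    ext q
    rw [S.mem_intersectionSection]
    simp only [mem_iUnion, mem_image]
    constructor
    · rintro ⟨u, w, hw, w', hw', rfl⟩
      obtain ⟨B, hB, hm⟩ : (u, w) ∈ ⋃₀ 𝓑 := by rw [h𝓑u]; trivial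
      exact ⟨B, hB, ((u, w), w'), ⟨⟨hm, trivial, hw⟩, hw'⟩, rfl⟩
    · rintro ⟨B, hB, ⟨⟨u, w⟩, w'⟩, ⟨⟨hm, -, hw⟩, hw'⟩, rfl⟩
      exact ⟨u, w, hw, w', hw', rfl⟩
  rw [hZ]
  refine MeasurableSet.biUnion h𝓑c fun B hB => ?_
  refine (((h𝓑o B hB).measurableSet.inter (MeasurableSet.univ.prod hW)).prod
    hW).image_of_continuousOn_injOn hf.continuousOn ?_
  rintro ⟨p, w⟩ ⟨hp, -⟩ ⟨p', w'⟩ ⟨hp', -⟩ he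
  have h1 : p = p' := h𝓑i B hB hp.1 hp'.1 (congrArg Prod.fst he)
  subst h1
  have h2 := S.mk_eq_mk_iff.1 (congrArg Prod.snd he)
  have h3 := congrArg Prod.snd (S.eq_of_fst_eq h2 S.Γ.zero_mem (by simp))
  have h4 : w' = w := sub_eq_zero.1 h3
  rw [h4]

theorem sub_mem_crossSection_of_mem {W : Set H} {q : S.Space × S.Space}
    (hq : q ∈ intersectionSection S.action (S.crossSection W)) :
    q.2 - q.1 ∈ S.crossSection (W - W) := by
  obtain ⟨u, w, hw, w', hw', rfl⟩ := S.mem_intersectionSection.1 hq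
  refine ⟨w' - w, sub_mem_sub hw' hw, ?_⟩
  simp only
  rw [← QuotientAddGroup.mk_sub]
  congr 1
  ext <;> simp

/-- Here `x = Γp` and `x' = Γ(p + (0, a - b))`; a lattice translate must put both `H`-coordinates
into `U` at once. That asks for a point of the open set `U ∩ (U - (a - b))`, which contains `b`, so
density provides it. -/
theorem mem_intersectionSection_of_sub_mem {W U : Set H} (hU : IsOpen U) (hUW : U ⊆ W)
    {q : S.Space × S.Space} (hq : q.2 - q.1 ∈ S.crossSection (U - U)) :
    q ∈ intersectionSection S.action (S.crossSection W) := by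
  obtain ⟨x, x'⟩ := q
  obtain ⟨d, ⟨a, ha, b, hb, rfl⟩, hd⟩ := hq
  obtain ⟨p, rfl⟩ := QuotientAddGroup.mk_surjective x
  obtain rfl : x' = QuotientAddGroup.mk (p + (0, a - b)) := by
    rw [QuotientAddGroup.mk_add]
    exact (add_eq_of_eq_sub' hd).symm
  obtain ⟨γ, hγ, h1, h2⟩ := S.exists_mem_lattice
    (hU.inter (hU.preimage (continuous_add_const (a - b)))) ⟨b, hb, by simpa using ha⟩ p.2
  refine S.mem_intersectionSection.2 ⟨p.1 + γ.1, _, hUW h1, _, hUW h2, ?_⟩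
  refine Prod.ext (S.mk_eq_mk_iff.2 ?_) (S.mk_eq_mk_iff.2 ?_)
  · convert hγ using 1
    ext <;> simp
  · convert hγ using 1
    ext <;> simp

/-! ### The transverse measure in difference coordinates. -/

theorem sub_action (g : G) (x x' : S.Space) :
    x' - S.action.act g x = S.action.act (-g) (x' - x) := by
  change x' - (x + QuotientAddGroup.mk (-g, 0)) = (x' - x) + QuotientAddGroup.mk (-(-g), 0)
  have : (QuotientAddGroup.mk (-(-g), 0) : S.Space) = - QuotientAddGroup.mk (-g, 0) := by
    rw [← QuotientAddGroup.mk_neg]; simp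
  rw [this]; abel

instance instIsNegInvariant : S.haarProb.IsNegInvariant := by
  refine ⟨?_⟩
  rw [Measure.neg_def, haarProb, Measure.map_smul, Measure.map_neg_eq_self]

/-- Needed for Tonelli. The index set varies with `q.1`, but after pulling back along the surjection
from `G × H` the sum runs over the fixed countable `Γ`; measurability descends because the spaces
are standard Borel. -/
theorem measurable_tsum_returnTimes {D : Set H} (hD : MeasurableSet D)
    {E : S.Space × (G × S.Space) → ℝ≥0∞} (hE : Measurable E) :
    Measurable fun q : S.Space × S.Space =>
      ∑' k : returnTimes S.action (S.crossSection D) q.1, E (q.2, (-(k : G), S.action.act k q.1)) := by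
  have := polishSpace_of_lcsc G
  have := polishSpace_of_lcsc H
  have := polishSpace_of_lcsc S.Space
  have := S.countable_lattice
  have : StandardBorelSpace S.Space := inferInstance
  have : StandardBorelSpace (S.Space × S.Space) := StandardBorelSpace.prod
  have : MeasurableSpace.CountablySeparated (S.Space × S.Space) :=
    MeasurableSpace.countablySeparated_of_separatesPoints
  have hmk := S.continuous_mk_zero.measurable
  have hDm : MeasurableSet {q : G × H | q.2 ∈ D} := measurable_snd hD
  refine (Measurable.measurable_comp_iff_of_surjective
    (f := Prod.map (QuotientAddGroup.mk : G × H → S.Space) (id : S.Space → S.Space))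
    (S.measurable_mk.prodMap measurable_id)
    (QuotientAddGroup.mk_surjective.prodMap Function.surjective_id)).1 ?_
  have heq : ((fun q : S.Space × S.Space =>
      ∑' k : returnTimes S.action (S.crossSection D) q.1,
        E (q.2, (-(k : G), S.action.act k q.1))) ∘
      Prod.map (QuotientAddGroup.mk : G × H → S.Space) (id : S.Space → S.Space)) =
      fun q => ∑' γ : S.Γ, ((Prod.fst ⁻¹' {q : G × H | q.2 ∈ D}).indicator
        (fun q : (G × H) × S.Space => E (q.2, (-q.1.1, QuotientAddGroup.mk ((0 : G), q.1.2)))))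
        (γ +ᵥ q.1, q.2) := by
    funext q
    exact S.tsum_returnTimes D (fun r => E (q.2, r)) q.1
  rw [heq]
  refine Measurable.tsum fun γ => ?_
  refine Measurable.comp (Measurable.indicator ?_ (measurable_fst hDm))
    (((measurable_const_vadd γ).comp measurable_fst).prodMk measurable_snd)
  exact hE.comp (measurable_snd.prodMk ((measurable_fst.comp measurable_fst).neg.prodMk
    (hmk.comp (measurable_snd.comp measurable_fst))))

/-- The map `(z, x') ↦ (x' - z, x')`. -/
def subLeft (q : S.Space × S.Space) : S.Space × S.Space := (q.2 - q.1, q.2)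

theorem measurable_subLeft : Measurable S.subLeft :=
  (measurable_snd.sub measurable_fst).prodMk measurable_snd

/-- The transverse measure of the intersection section, seen as a measure on `Ξ × Ξ`. -/
noncomputable def intersectionMeasure (W D : Set H) : Measure (S.Space × S.Space) :=
  (Measure.map S.subLeft ((S.sectionMeasure D).prod S.haarProb)).restrict
    (intersectionSection S.action (S.crossSection W))

/-- Substitute `k = -g`. Every return to `Y_W^[2]` gives a return of the difference to `Y_D`; the
extra returns to `Y_D` are killed by the indicator. -/
theorem tsum_returnTimes_intersectionSection {W D : Set H} (hWD : W - W ⊆ D)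
    (F : G × (S.Space × S.Space) → ℝ≥0∞) (x x' : S.Space) :
    ∑' g : returnTimes S.action.onFst (intersectionSection S.action (S.crossSection W)) (x, x'),
      F (-(g : G), S.action.onFst.act g (x, x')) =
    ∑' k : returnTimes S.action (S.crossSection D) (x' - x),
      (Prod.snd ⁻¹' intersectionSection S.action (S.crossSection W)).indicator F
        (k, S.subLeft (S.action.act k (x' - x), x')) := by
  set Z := intersectionSection S.action (S.crossSection W) with hZ
  have hsub : ∀ k : G, S.subLeft (S.action.act k (x' - x), x') = (S.action.act (-k) x, x') := by
    intro k
    have := S.sub_action (-k) x x'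
    rw [neg_neg] at this
    rw [subLeft, ← this, sub_sub_cancel]
  simp_rw [hsub]
  rw [tsum_subtype (returnTimes S.action.onFst Z (x, x'))
      (fun g => F (-g, S.action.onFst.act g (x, x'))),
    tsum_subtype (returnTimes S.action (S.crossSection D) (x' - x))
      (fun k => (Prod.snd ⁻¹' Z).indicator F (k, (S.action.act (-k) x, x'))),
    ← (Equiv.neg G).tsum_eq]
  refine tsum_congr fun k => ?_
  by_cases hk : (S.action.act (-k) x, x') ∈ Z
  · have h1 : -k ∈ returnTimes S.action.onFst Z (x, x') := hk
    have h2 : k ∈ returnTimes S.action (S.crossSection D) (x' - x) := by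
      have h3 := S.sub_mem_crossSection_of_mem hk
      simp only [S.sub_action, neg_neg] at h3
      exact image_mono hWD h3
    rw [Equiv.neg_apply, indicator_of_mem h1, indicator_of_mem h2, indicator_of_mem, neg_neg]
    · rfl
    · exact hk
  · have h1 : -k ∉ returnTimes S.action.onFst Z (x, x') := hk
    have h2 : (k, (S.action.act (-k) x, x')) ∉ (Prod.snd ⁻¹' Z : Set (G × (S.Space × S.Space))) :=
      hk
    rw [Equiv.neg_apply, indicator_of_notMem h1]
    simp only [indicator, h2, if_false, ite_self]

theorem isFiniteMeasure_intersectionMeasure (W : Set H) {D : Set H} (hDt : mH D < ∞) :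
    IsFiniteMeasure (S.intersectionMeasure W D) := by
  have := S.isFiniteMeasure_sectionMeasure hDt
  unfold intersectionMeasure
  infer_instance

theorem isTransverseMeasure_intersectionSection {W D : Set H} (hW : MeasurableSet W)
    (hD : MeasurableSet D) (hDt : mH D < ∞) (hWD : W - W ⊆ D) :
    IsTransverseMeasure mG S.action.onFst (S.haarProb.prod S.haarProb)
      (intersectionSection S.action (S.crossSection W))
      ((S.intersectionMeasure W D).comap (↑)) := by
  have := S.isFiniteMeasure_sectionMeasure hDt
  have := S.isFiniteMeasure_intersectionMeasure W hDt
  have hZ := S.measurableSet_intersectionSection hW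
  refine isTransverseMeasure_comap hZ _ ?_ fun F hF => ?_
  · rw [intersectionMeasure, Measure.restrict_apply hZ.compl, compl_inter_self, measure_empty]
  set F' : G × (S.Space × S.Space) → ℝ≥0∞ :=
    (Prod.snd ⁻¹' intersectionSection S.action (S.crossSection W)).indicator F with hF'
  have hF'm : Measurable F' := hF.indicator (measurable_snd hZ)
  -- The sign compensates for the `-k` in the Campbell formula for `Y_D`, as the difference moves
  -- opposite to `x`.
  let E : S.Space × (G × S.Space) → ℝ≥0∞ := fun r => F' (-r.2.1, S.subLeft (r.2.2, r.1))
  have hE : Measurable E := hF'm.comp ((measurable_fst.comp measurable_snd).neg.prodMk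
    (S.measurable_subLeft.comp ((measurable_snd.comp measurable_snd).prodMk measurable_fst)))
  let P : S.Space × S.Space → ℝ≥0∞ := fun q =>
    ∑' k : returnTimes S.action (S.crossSection D) q.1, E (q.2, (-(k : G), S.action.act k q.1))
  have hP : Measurable P := S.measurable_tsum_returnTimes hD hE
  have hsum : ∀ q : S.Space × S.Space,
      ∑' g : returnTimes S.action.onFst (intersectionSection S.action (S.crossSection W)) q,
        F (-(g : G), S.action.onFst.act g q) = P (q.2 - q.1, q.2) := by
    intro q
    rw [S.tsum_returnTimes_intersectionSection hWD F q.1 q.2]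
    refine tsum_congr fun k => ?_
    simp only [E, neg_neg, hF']
  have hPm : Measurable fun q : S.Space × S.Space => P (q.2 - q.1, q.2) :=
    hP.comp S.measurable_subLeft
  have hleft : ∫⁻ p, F p ∂(mG.prod (S.intersectionMeasure W D)) =
      ∫⁻ p, F' (p.1, S.subLeft p.2) ∂(mG.prod ((S.sectionMeasure D).prod S.haarProb)) := by
    have h1 := Measure.map_prod_map mG ((S.sectionMeasure D).prod S.haarProb)
      measurable_id S.measurable_subLeft
    rw [Measure.map_id] at h1
    have h2 : mG.prod (S.intersectionMeasure W D) =
        (mG.prod (Measure.map S.subLeft ((S.sectionMeasure D).prod S.haarProb))).restrict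
          (Prod.snd ⁻¹' intersectionSection S.action (S.crossSection W)) := by
      have := Measure.prod_restrict (μ := mG)
        (ν := Measure.map S.subLeft ((S.sectionMeasure D).prod S.haarProb)) univ
        (intersectionSection S.action (S.crossSection W))
      rw [Measure.restrict_univ, univ_prod] at this
      exact this
    rw [h2, ← lintegral_indicator (measurable_snd hZ), h1,
      lintegral_map hF'm (measurable_id.prodMap S.measurable_subLeft)]
    rfl
  have hneg : MeasurePreserving (Prod.map Neg.neg id : G × S.Space → G × S.Space)
      (mG.prod (S.sectionMeasure D)) (mG.prod (S.sectionMeasure D)) :=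
    (Measure.measurePreserving_neg mG).prod (MeasurePreserving.id _)
  have hT : Measurable fun r : (G × S.Space) × S.Space => F' (r.1.1, S.subLeft (r.1.2, r.2)) :=
    hF'm.comp ((measurable_fst.comp measurable_fst).prodMk
      (S.measurable_subLeft.comp ((measurable_snd.comp measurable_fst).prodMk measurable_snd)))
  have hassoc : ∫⁻ p, F' (p.1, S.subLeft p.2) ∂(mG.prod ((S.sectionMeasure D).prod S.haarProb)) =
      ∫⁻ r, F' (r.1.1, S.subLeft (r.1.2, r.2))
        ∂((mG.prod (S.sectionMeasure D)).prod S.haarProb) := by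
    have h := (measurePreserving_prodAssoc mG (S.sectionMeasure D) S.haarProb)
    exact (h.lintegral_comp (f := fun p => F' (p.1, S.subLeft p.2))
      (hF'm.comp (measurable_fst.prodMk (S.measurable_subLeft.comp measurable_snd)))).symm
  rw [hleft, hassoc, lintegral_prod_symm _ hT.aemeasurable]
  simp_rw [hsum]
  rw [lintegral_prod_symm _ hPm.aemeasurable]
  -- For fixed `x'`, the substitution `z = x' - x` preserves `ξ` and reduces the claim to the
  -- Campbell formula for `Y_D`.
  refine lintegral_congr fun x' => ?_
  simp only
  rw [lintegral_sub_left_eq_self (fun z => P (z, x')) x']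
  have hEx : Measurable fun r : G × S.Space => E (x', r) := hE.comp measurable_prodMk_left
  have hL := S.lintegral_tsum_returnTimes hD hEx
  refine Eq.trans ?_ hL.symm
  rw [← hneg.lintegral_comp hEx]
  simp [E]

/-! ### Bounds on the intersection covolume and transversality of the intersection section. -/

theorem intersectionCovolume_eq {W D : Set H} (hW : MeasurableSet W)
    (hD : MeasurableSet D) (hDt : mH D < ∞) (hWD : W - W ⊆ D) :
    intersectionCovolume mG S.action S.haarProb (S.crossSection W) =
      ((S.sectionMeasure D).prod S.haarProb)
        (S.subLeft ⁻¹' intersectionSection S.action (S.crossSection W)) := by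
  have hZ := S.measurableSet_intersectionSection hW
  rw [intersectionCovolume, (S.isTransverseMeasure_intersectionSection hW hD hDt hWD).intensity_eq,
    (MeasurableEmbedding.subtype_coe hZ).comap_apply, image_univ, Subtype.range_coe,
    intersectionMeasure, Measure.restrict_apply_self, Measure.map_apply S.measurable_subLeft hZ]

theorem intersectionCovolume_le {W D : Set H} (hW : MeasurableSet W)
    (hD : MeasurableSet D) (hDt : mH D < ∞) (hWD : W - W ⊆ D) :
    intersectionCovolume mG S.action S.haarProb (S.crossSection W) ≤ S.covol⁻¹ * mH D := by
  have := S.isFiniteMeasure_sectionMeasure hDt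
  rw [S.intersectionCovolume_eq hW hD hDt hWD]
  refine (measure_mono (subset_univ _)).trans ?_
  rw [← univ_prod_univ, Measure.prod_prod, measure_univ (μ := S.haarProb), mul_one, sectionMeasure_univ]

theorem le_intersectionCovolume {U W D : Set H} (hU : IsOpen U) (hUW : U ⊆ W)
    (hW : MeasurableSet W) (hD : MeasurableSet D) (hDt : mH D < ∞) (hWD : W - W ⊆ D) :
    S.covol⁻¹ * mH (U - U) ≤
      intersectionCovolume mG S.action S.haarProb (S.crossSection W) := by
  have := S.isFiniteMeasure_sectionMeasure hDt
  have hUU : MeasurableSet (U - U) := (hU.sub_right (s := U)).measurableSet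
  have hY := S.measurableSet_crossSection hUU
  have hmk := S.continuous_mk_zero.measurable
  rw [S.intersectionCovolume_eq hW hD hDt hWD]
  have hsub : S.crossSection (U - U) ×ˢ univ ⊆
      S.subLeft ⁻¹' intersectionSection S.action (S.crossSection W) := by
    rintro ⟨z, x'⟩ ⟨hz, -⟩
    refine S.mem_intersectionSection_of_sub_mem hU hUW ?_
    simpa [subLeft] using hz
  refine le_trans (le_of_eq ?_) (measure_mono hsub)
  rw [Measure.prod_prod, measure_univ (μ := S.haarProb), mul_one, sectionMeasure, Measure.smul_apply,
    Measure.map_apply hmk hY, Measure.restrict_apply (hmk hY), smul_eq_mul,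
    crossSection, preimage_image_eq _ S.injective_mk_zero,
    inter_eq_left.2 ((sub_subset_sub hUW hUW).trans hWD)]

theorem isTransverseSpace_intersectionSection {U W C D : Set H} (hU : IsOpen U) (hne : U.Nonempty)
    (hUW : U ⊆ W) (hW : MeasurableSet W) (hD : MeasurableSet D) (hWD : W - W ⊆ D)
    (hC : IsCompact C) (hDC : D ⊆ C) :
    IsTransverseSpace S.action.onFst (S.haarProb.prod S.haarProb)
      (intersectionSection S.action (S.crossSection W)) where
  isProbabilityMeasure := inferInstance
  measurePreserving g := (S.measurePreserving_action g).prod (MeasurePreserving.id _)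
  isCrossSection :=
    { measurableSet := S.measurableSet_intersectionSection hW
      nonempty := by
        rintro ⟨x, x'⟩
        obtain ⟨k, hk⟩ := S.returnTimes_nonempty (hU.sub_right (s := U)) (hne.sub hne)
          subset_rfl (x' - x)
        refine ⟨-k, S.mem_intersectionSection_of_sub_mem hU hUW ?_⟩
        change x' - S.action.act (-k) x ∈ _
        rw [S.sub_action, neg_neg]
        exact hk
      locallyFinite := by
        rintro ⟨x, x'⟩ K hK
        refine ((S.returnTimes_inter_finite hC hDC (x' - x) hK.neg).image Neg.neg).subset ?_
        rintro g ⟨hg, hgK⟩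
        refine ⟨-g, ⟨?_, by simpa using hgK⟩, neg_neg g⟩
        have h : x' - S.action.act g x ∈ S.crossSection (W - W) :=
          S.sub_mem_crossSection_of_mem hg
        rw [S.sub_action] at h
        exact image_mono hWD h }
  locallyIntegrable := fun K hK => by
    have hDt : mH D < ∞ := (measure_mono hDC).trans_lt hC.measure_lt_top
    have := S.isFiniteMeasure_intersectionMeasure W hDt
    refine (S.isTransverseMeasure_intersectionSection hW hD hDt hWD).lintegral_encard_lt_top ?_ hK
    rw [(MeasurableEmbedding.subtype_coe (S.measurableSet_intersectionSection hW)).comap_apply]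
    exact measure_lt_top _ _

end CutAndProjectScheme

/-! ### Windows and the conclusion. -/

theorem IsWindow.measure_interior {H : Type*} [TopologicalSpace H] [MeasurableSpace H]
    {m : Measure H} {W : Set H} (hW : IsWindow m W) : m (interior W) = m W := by
  refine le_antisymm (measure_mono interior_subset) ?_
  have hsub : W ⊆ interior W ∪ frontier W := by
    rw [← closure_eq_interior_union_frontier]; exact subset_closure
  refine (measure_mono hsub).trans ((measure_union_le _ _).trans ?_)
  have : m (frontier W) = 0 := hW.jordan
  rw [this, add_zero]

theorem theoremB {G H : Type*}
    [AddCommGroup G] [TopologicalSpace G] [IsTopologicalAddGroup G] [LocallyCompactSpace G]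
    [SecondCountableTopology G] [T2Space G] [MeasurableSpace G] [BorelSpace G]
    [AddCommGroup H] [TopologicalSpace H] [IsTopologicalAddGroup H] [LocallyCompactSpace H]
    [SecondCountableTopology H] [T2Space H] [MeasurableSpace H] [BorelSpace H]
    (mG : Measure G) [mG.IsAddHaarMeasure] (mH : Measure H) [mH.IsAddHaarMeasure]
    (S : CutAndProjectScheme mG mH) (W : Set H) (hW : IsWindow mH W) :
    -- the objects are well defined: both spaces are transverse, with a unique transverse measure
    (IsTransverseSpace S.action S.haarProb (S.crossSection W) ∧
      (∃! ν, IsTransverseMeasure mG S.action S.haarProb (S.crossSection W) ν) ∧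
      IsTransverseSpace S.action.onFst (S.haarProb.prod S.haarProb)
        (intersectionSection S.action (S.crossSection W)) ∧
      (∃! ν, IsTransverseMeasure mG S.action.onFst (S.haarProb.prod S.haarProb)
        (intersectionSection S.action (S.crossSection W)) ν)) ∧
    -- the intensity
    (intensity mG S.action S.haarProb (S.crossSection W) = S.covol⁻¹ * mH W ∧
      intensity mG S.action S.haarProb (S.crossSection (interior W)) =
        intensity mG S.action S.haarProb (S.crossSection W)) ∧
    -- the intersection covolume
    (IsOpen W ∨ IsJordanMeasurable mH (W - W) →
      S.covol⁻¹ * mH (interior W - interior W) ≤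
          intersectionCovolume mG S.action S.haarProb (S.crossSection W) ∧
        intersectionCovolume mG S.action S.haarProb (S.crossSection W) ≤
          S.covol⁻¹ * mH (W - W)) := by
  have hWm := hW.measurableSet
  have hint : (interior W).Nonempty := by
    refine nonempty_of_measure_ne_zero (μ := mH) ?_
    rw [hW.measure_interior]
    exact hW.measure_pos.ne'
  have hC := hW.relativelyCompact
  have hCC : IsCompact (closure W - closure W) := by
    rw [sub_eq_add_neg]; exact hC.add hC.neg
  -- `W - W` need not be Borel, so a measurable hull of the same measure replaces it; the
  -- intersection with a compact set keeps return times locally finite.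
  obtain ⟨D, hD, hWD, hDC, hDm⟩ : ∃ D, MeasurableSet D ∧ W - W ⊆ D ∧
      D ⊆ closure W - closure W ∧ mH D ≤ mH (W - W) :=
    ⟨toMeasurable mH (W - W) ∩ (closure W - closure W),
      (measurableSet_toMeasurable _ _).inter hCC.isClosed.measurableSet,
      subset_inter (subset_toMeasurable _ _) (sub_subset_sub subset_closure subset_closure),
      inter_subset_right, (measure_mono inter_subset_left).trans (measure_toMeasurable _).le⟩
  have hDt : mH D < ∞ := (measure_mono hDC).trans_lt hCC.measure_lt_top
  refine ⟨⟨S.isTransverseSpace_crossSection isOpen_interior hint interior_subset hWm hC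
      subset_closure, (S.isTransverseMeasure_crossSection hWm hW.measure_lt_top).existsUnique,
      S.isTransverseSpace_intersectionSection isOpen_interior hint interior_subset hWm hD hWD
        hCC hDC,
      (S.isTransverseMeasure_intersectionSection hWm hD hDt hWD).existsUnique⟩,
    ⟨S.intensity_crossSection hWm hW.measure_lt_top, ?_⟩,
    fun _ => ⟨S.le_intersectionCovolume isOpen_interior interior_subset hWm hD hDt hWD,
      (S.intersectionCovolume_le hWm hD hDt hWD).trans (mul_le_mul_right hDm _)⟩⟩
  rw [S.intensity_crossSection isOpen_interior.measurableSet
      (hW.measure_interior.trans_lt hW.measure_lt_top),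
    S.intensity_crossSection hWm hW.measure_lt_top, hW.measure_interior]
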